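/- Let $(M,g)$ be a smooth Riemannian manifold of dimension $n$, let $R$ be its Riemann curvature tensor, regarded as a double form of bidegree $(2,2)$, that is, as a field of bilinear forms on $\Lambda^2TM$, with the sign convention that $R(u\wedge v,u\wedge v)$ is the sectional curvature of the plane spanned by two orthonormal vectors $u,v$. For a double form $\omega$ of bidegree $(p,q)$ with $p,q\ge 1$, the contraction $c(\omega)$ is the double form of bidegree $(p-1,q-1)$ given by $$c(\omega)(x_1\wedge\dots\wedge x_{p-1},\,y_1\wedge\dots\wedge y_{q-1})=\sum_{j=1}^n\omega(e_j\wedge x_1\wedge\dots\wedge x_{p-1},\,e_j\wedge y_1\wedge\dots\wedge y_{q-1}),$$ where $(e_1,\dots,e_n)$ is any orthonormal basis of the tangent space; thus $c(R)$ is the Ricci curvature and $c^2(R)$ is the scalar curvature. Let $|\cdot|$ be the norm of the natural inner product induced by $g$ on $\Lambda^pT^*M\otimes\Lambda^qT^*M$ (so $|\omega|^2$ is the sum of the squares $\omega(e_I,e_J)^2$ over strictly increasing multi-indices $I,J$ of lengths $p,q$). The second H. Weyl curvature invariant is the function $$h_4=|R|^2-|c(R)|^2+\tfrac14|c^2(R)|^2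 .$$ The metric $g$ is called flat if $R\equiv 0$; Einstein if $c(R)=\lambda g$ for a constant $\lambda\in\mathbb R$; and conformally flat if every point of $M$ has an open neighbourhood $U$ with a smooth function $f:U\to\mathbb R$ such that the metric $e^{2f}g$ on $U$ is flat. Suppose that $n\ge 4$. 1. If $(M,g)$ is an Einstein manifold, then $h_4\ge 0$ on $M$, and $h_4\equiv 0$ if and only if $(M,g)$ is flat. 2. If $(M,g)$ is conformally flat and has zero scalar curvature, then $h_4\le 0$ on $M$, and $h_4\equiv 0$ if and only if $(M,g)$ is flat. -/

import Mathlib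

open scoped Manifold ContDiff

noncomputable section

namespace HWeyl

section Algebra

variable {n p q : ℕ}

/-- Components, in a basis `∂₁, …, ∂ₙ` of a vector space `V`, of a double form of bidegree
`(p, q)`: the numbers `η (∂_{I 0} ∧ ⋯ ∧ ∂_{I (p-1)}, ∂_{J 0} ∧ ⋯ ∧ ∂_{J (q-1)})`. -/
abbrev DoubleForm (n p q : ℕ) : Type := (Fin p → Fin n) → (Fin q → Fin n) → ℝ

/-- The contraction `c : D^{p+1,q+1} → D^{p,q}` with respect to the inner product whose Gram matrix
in the basis `∂₁, …, ∂ₙ` is `G`: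
`(c η)(I, J) = ∑ₐ ∑_b g^{ab} η(∂ₐ ∧ ∂_I, ∂_b ∧ ∂_J)`, with `g^{ab}` the entries of the inverse
of `G`. If the basis is orthonormal then this is `∑ₐ η(∂ₐ ∧ ∂_I, ∂ₐ ∧ ∂_J)`. -/
def contraction (G : Matrix (Fin n) (Fin n) ℝ) (η : DoubleForm n (p + 1) (q + 1)) :
    DoubleForm n p q :=
  fun I J => ∑ a, ∑ b, G⁻¹ a b * η (Fin.cons a I) (Fin.cons b J)

/-- The squared norm `|η|²` for the natural inner product on `D^{p,q} = Λᵖ V* ⊗ Λ^q V*` induced by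
the inner product of Gram matrix `G`. If the basis `∂₁, …, ∂ₙ` is orthonormal then this is the sum
of the squares `η(∂_I, ∂_J)²` over the strictly increasing multi-indices `I` and `J`. -/
def normSq (G : Matrix (Fin n) (Fin n) ℝ) (η : DoubleForm n p q) : ℝ :=
  1 / ((p.factorial : ℝ) * (q.factorial : ℝ)) *
    ∑ I, ∑ I', ∑ J, ∑ J',
      (∏ s, G⁻¹ (I s) (I' s)) * (∏ t, G⁻¹ (J t) (J' t)) * η I J * η I' J'

end Algebra

section Geometry

variable {n : ℕ} {M : Type*} [TopologicalSpace M] [ChartedSpace (EuclideanSpace ℝ (Fin n)) M]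

/-- Fields of bilinear forms on the tangent spaces of an `n`-dimensional manifold `M`. -/
abbrev BilinField (n : ℕ) (M : Type*) [TopologicalSpace M]
    [ChartedSpace (EuclideanSpace ℝ (Fin n)) M] : Type _ :=
  ∀ x : M, TangentSpace (𝓡 n) x →L[ℝ] TangentSpace (𝓡 n) x →L[ℝ] ℝ

/-- The `i`-th coordinate vector field `∂ᵢ` of the preferred chart at `x`, at the point with
coordinates `y`. -/
def coordVec (x : M) (y : EuclideanSpace ℝ (Fin n)) (i : Fin n) :
    TangentSpace (𝓡 n) ((extChartAt (𝓡 n) x).symm y) :=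
  mfderiv 𝓘(ℝ, EuclideanSpace ℝ (Fin n)) (𝓡 n) (extChartAt (𝓡 n) x).symm y
    (EuclideanSpace.single i (1 : ℝ))

/-- The matrix `g_{ij} = g(∂ᵢ, ∂ⱼ)` of `g` in the preferred chart at `x`, as a function of the
coordinates `y`. -/
def coeff (g : BilinField n M) (x : M) (y : EuclideanSpace ℝ (Fin n)) :
    Matrix (Fin n) (Fin n) ℝ :=
  Matrix.of fun i j => g ((extChartAt (𝓡 n) x).symm y) (coordVec x y i) (coordVec x y j)

/-- The partial derivative `∂ᵢ F` at `y` of a function `F` of `n` real variables. -/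
def partialDeriv (i : Fin n) (F : EuclideanSpace ℝ (Fin n) → ℝ) (y : EuclideanSpace ℝ (Fin n)) :
    ℝ :=
  fderiv ℝ F y (EuclideanSpace.single i (1 : ℝ))

/-- The Christoffel symbols of the Levi-Civita connection of `g` in the preferred chart at `x`:
`Γᵏᵢⱼ = ½ ∑ₗ g^{kl} (∂ᵢ g_{jl} + ∂ⱼ g_{il} - ∂ₗ g_{ij})`. -/
def christoffel (g : BilinField n M) (x : M) (k i j : Fin n) (y : EuclideanSpace ℝ (Fin n)) : ℝ :=
  1 / 2 * ∑ l, (coeff g x y)⁻¹ k l *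
    (partialDeriv i (fun z => coeff g x z j l) y + partialDeriv j (fun z => coeff g x z i l) y
      - partialDeriv l (fun z => coeff g x z i j) y)

/-- The component along `∂ₘ` of
`R(∂ᵢ, ∂ⱼ) ∂ₗ = ∇_{∂ᵢ} ∇_{∂ⱼ} ∂ₗ - ∇_{∂ⱼ} ∇_{∂ᵢ} ∂ₗ`
in the preferred chart at `x`, at the point with coordinates `y`. -/
def curvatureCoeff (g : BilinField n M) (x : M) (m l i j : Fin n)
    (y : EuclideanSpace ℝ (Fin n)) : ℝ :=
  partialDeriv i (christoffel g x m j l) y - partialDeriv j (christoffel g x m i l) y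
    + ∑ a, (christoffel g x m i a y * christoffel g x a j l y
      - christoffel g x m j a y * christoffel g x a i l y)

/-- The Gram matrix `g_{ij}` of `g` at the point `x` itself, in the basis of the tangent space at
`x` given by the preferred chart at `x`. -/
def gram (g : BilinField n M) (x : M) : Matrix (Fin n) (Fin n) ℝ :=
  coeff g x (extChartAt (𝓡 n) x x)

/-- The Riemann curvature tensor of `g` at the point `x`, as a double form of bidegree `(2, 2)`, in
the basis of the tangent space at `x` given by the preferred chart at `x`:
`R(∂ᵢ ∧ ∂ⱼ, ∂ₖ ∧ ∂ₗ) = g(R(∂ᵢ, ∂ⱼ) ∂ₗ, ∂ₖ)`, so that `R(u ∧ v, u ∧ v)` is the sectional curvature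
of the plane spanned by two orthonormal vectors `u`, `v`. -/
def riemann (g : BilinField n M) (x : M) : DoubleForm n 2 2 :=
  fun I J => ∑ m, gram g x (J 0) m *
    curvatureCoeff g x m (J 1) (I 0) (I 1) (extChartAt (𝓡 n) x x)

/-- The Ricci curvature `c R` at `x`. -/
def ricci (g : BilinField n M) (x : M) : DoubleForm n 1 1 := contraction (gram g x) (riemann g x)

/-- The double form `c² R` of bidegree `(0, 0)` at `x`. -/
def scal₀ (g : BilinField n M) (x : M) : DoubleForm n 0 0 := contraction (gram g x) (ricci g x)

/-- The scalar curvature at `x`, which is the number `c² R`. -/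
def scalarCurvature (g : BilinField n M) (x : M) : ℝ := scal₀ g x ![] ![]

/-- The second H. Weyl curvature invariant `h₄ = |R|² - |c R|² + ¼ |c² R|²` at `x`. -/
def h₄ (g : BilinField n M) (x : M) : ℝ :=
  normSq (gram g x) (riemann g x) - normSq (gram g x) (ricci g x)
    + 1 / 4 * normSq (gram g x) (scal₀ g x)

/-- `g` is flat on `U`: its Riemann curvature tensor vanishes at every point of `U`. -/
def IsFlatOn (g : BilinField n M) (U : Set M) : Prop := ∀ x ∈ U, riemann g x = 0

/-- `g` is an Einstein metric: `Ric = lam • g` for a constant `lam`. -/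
def IsEinstein (g : BilinField n M) : Prop :=
  ∃ lam : ℝ, ∀ (x : M) (i j : Fin n), ricci g x ![i] ![j] = lam * gram g x i j

/-- `g` is (locally) conformally flat: every point has an open neighbourhood `U` with a smooth
function `f` on `U` such that the metric `e^{2f} g` is flat on `U`. -/
def IsConformallyFlat (g : BilinField n M) : Prop :=
  ∀ x : M, ∃ (U : Set M) (f : M → ℝ), IsOpen U ∧ x ∈ U ∧ ContMDiffOn (𝓡 n) 𝓘(ℝ, ℝ) ∞ f U ∧
    IsFlatOn (fun z => Real.exp (2 * f z) • g z) U

end Geometry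

end HWeyl

end

namespace HWeyl

open scoped Topology

/-! Both parts compare `h₄` with `|R|²` at a single point. Since `normSq` is positive definite
(`normSq_pos`), a bound of `h₄` by a nonzero multiple of `|R|²` settles both the sign and the
flatness statement.

Einstein case: if `Ric = λ g`, then `|cR|² = nλ²` and `c²R = nλ`, so `h₄ = |R|² + n(n-4)λ²/4 ≥ |R|²`
for `n ≥ 4` (`normSq_riemann_le_h₄`).

Conformally flat case: under `g ↦ e^{2f} g` the curvature, with its index lowered by `g`, changes by
`-g ∧ A`, where `A = Hess f - df ⊗ df + ½|df|² g` (`lower_matrixCurvature_conformal`). If the new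
metric is flat, then `R = g ∧ A` (`IsConformallyFlat.exists_riemann_eq`). Now `c(g ∧ A) = (n-2)A +
(tr A) g` and `c²(g ∧ A) = (2n-2) tr A`, so zero scalar curvature forces `tr A = 0` and `cR =
(n-2)A`. As `c` is adjoint to multiplication by `g`, `|R|² = ⟨cR, A⟩`, that is `(n-2)|R|² = |cR|²`
(`normSq_kulkarniNomizu`), whence `h₄ = -(n-3)|R|²`. -/

/-! ### Positive definiteness of the norm on double forms -/

theorem posDef_prod_entries {n : ℕ} (p : ℕ) {A : Matrix (Fin n) (Fin n) ℝ} (hA : A.PosDef) :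
    (Matrix.of fun I I' : Fin p → Fin n => ∏ s, A (I s) (I' s)).PosDef := by
  -- The tensor power of matrices is multiplicative. Hence `A = BᵀB` makes the power of `A` a Gram
  -- matrix, so semidefinite, and the power of `A⁻¹` inverts it, so it is definite.
  have hmul : ∀ B C : Matrix (Fin n) (Fin n) ℝ,
      (Matrix.of fun I I' : Fin p → Fin n => ∏ s, (B * C) (I s) (I' s)) =
      (Matrix.of fun I I' : Fin p → Fin n => ∏ s, B (I s) (I' s)) *
      (Matrix.of fun I I' : Fin p → Fin n => ∏ s, C (I s) (I' s)) := by
    intro B C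
    ext I I'
    simp only [Matrix.of_apply, Matrix.mul_apply, Finset.prod_univ_sum, Fintype.piFinset_univ,
      Finset.prod_mul_distrib]
  have hone : (Matrix.of fun I I' : Fin p → Fin n =>
      ∏ s, (1 : Matrix (Fin n) (Fin n) ℝ) (I s) (I' s)) = 1 := by
    ext I I'
    simp only [Matrix.of_apply, Matrix.one_apply, Finset.prod_ite_zero, funext_iff]
    simp
  obtain ⟨B, hB⟩ : ∃ B : Matrix (Fin n) (Fin n) ℝ, A = B.transpose * B := by
    open scoped MatrixOrder in
    obtain ⟨B, hB⟩ := CStarAlgebra.nonneg_iff_eq_star_mul_self.mp hA.posSemidef.nonneg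
    exact ⟨B, by simpa [Matrix.star_eq_conjTranspose] using hB⟩
  have hps : (Matrix.of fun I I' : Fin p → Fin n => ∏ s, A (I s) (I' s)).PosSemidef := by
    rw [hB, hmul]
    have := Matrix.posSemidef_conjTranspose_mul_self
      (Matrix.of fun I I' : Fin p → Fin n => ∏ s, B (I s) (I' s))
    convert this using 2
    ext I I'
    simp
  rw [hps.posDef_iff_isUnit]
  have hu : A * A⁻¹ = 1 := Matrix.mul_nonsing_inv _ ((Matrix.isUnit_iff_isUnit_det _).1 hA.isUnit)
  refine IsUnit.of_mul_eq_one
    (Matrix.of fun I I' : Fin p → Fin n => ∏ s, A⁻¹ (I s) (I' s)) ?_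
  rw [← hmul, hu, hone]

/-- Up to a positive factor, the norm is the quadratic form of the Kronecker product of two tensor
powers of `G⁻¹`. Antisymmetry of `η` plays no role. -/
theorem normSq_pos {n p q : ℕ} {G : Matrix (Fin n) (Fin n) ℝ} (hG : G.PosDef)
    {η : DoubleForm n p q} (hη : η ≠ 0) : 0 < normSq G η := by
  have h := ((posDef_prod_entries p hG.inv).kronecker
    (posDef_prod_entries q hG.inv)).dotProduct_mulVec_pos (x := fun z => η z.1 z.2) (by
      intro h0
      apply hη
      funext I J
      exact congrFun h0 (I, J))
  unfold normSq
  refine mul_pos (by positivity) (lt_of_lt_of_eq h ?_)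
  simp only [dotProduct, Matrix.mulVec, Matrix.kroneckerMap_apply, Matrix.of_apply,
    Fintype.sum_prod_type, Finset.mul_sum, Pi.star_apply, star_trivial]
  refine Finset.sum_congr rfl fun I _ => ?_
  rw [Finset.sum_comm]
  refine Finset.sum_congr rfl fun I' _ => Finset.sum_congr rfl fun J _ =>
    Finset.sum_congr rfl fun J' _ => by ring

theorem normSq_zero {n p q : ℕ} (G : Matrix (Fin n) (Fin n) ℝ) :
    normSq G (0 : DoubleForm n p q) = 0 := by
  simp [normSq]

theorem normSq_nonneg {n p q : ℕ} {G : Matrix (Fin n) (Fin n) ℝ} (hG : G.PosDef)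
    (η : DoubleForm n p q) : 0 ≤ normSq G η := by
  rcases eq_or_ne η 0 with rfl | h
  · rw [normSq_zero]
  · exact (normSq_pos hG h).le

theorem eq_zero_of_normSq_eq_zero {n p q : ℕ} {G : Matrix (Fin n) (Fin n) ℝ} (hG : G.PosDef)
    {η : DoubleForm n p q} (h : normSq G η = 0) : η = 0 := by
  by_contra h0
  exact (normSq_pos hG h0).ne' h

/-! ### Norms and contractions in components, in low bidegree -/

theorem contraction_zero {n p q : ℕ} (G : Matrix (Fin n) (Fin n) ℝ) :
    contraction G (0 : DoubleForm n (p + 1) (q + 1)) = 0 := by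
  funext I J
  simp [contraction]

theorem sum_fin_one {n : ℕ} (F : (Fin 1 → Fin n) → ℝ) : ∑ I, F I = ∑ i, F ![i] :=
  Fintype.sum_equiv (Equiv.funUnique (Fin 1) (Fin n)) _ _ fun I => by
    congr 1; ext s; fin_cases s; rfl

theorem sum_fin_two {n : ℕ} (F : (Fin 2 → Fin n) → ℝ) : ∑ I, F I = ∑ i, ∑ j, F ![i, j] := by
  rw [← Fintype.sum_prod_type']
  exact (Fintype.sum_equiv (finTwoArrowEquiv (Fin n)).symm _ _ fun I => rfl).symm

theorem normSq_bidegree_zero {n : ℕ} (G : Matrix (Fin n) (Fin n) ℝ) (η : DoubleForm n 0 0) :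
    normSq G η = η ![] ![] ^ 2 := by
  have h : ∀ I : Fin 0 → Fin n, I = ![] := fun I => Subsingleton.elim _ _
  simp [normSq, h, sq]

theorem normSq_bidegree_one {n : ℕ} (G : Matrix (Fin n) (Fin n) ℝ) (η : DoubleForm n 1 1) :
    normSq G η = ∑ i, ∑ k, η ![i] ![k] * ∑ i', ∑ k', G⁻¹ i i' * G⁻¹ k k' * η ![i'] ![k'] := by
  simp only [normSq, sum_fin_one, Finset.mul_sum]
  simp only [Nat.factorial_one, Nat.cast_one, mul_one, div_one, one_mul, Finset.univ_unique,
    Fin.default_eq_zero, Finset.prod_singleton, Matrix.cons_val_zero]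
  refine Finset.sum_congr rfl fun I _ => ?_
  rw [Finset.sum_comm]
  exact Finset.sum_congr rfl fun _ _ => Finset.sum_congr rfl fun _ _ =>
    Finset.sum_congr rfl fun _ _ => by ring

/-- The norm is arranged as a pairing of `η` with its copy with raised indices, so that the raised
factor can be computed on its own. -/
theorem normSq_bidegree_two {n : ℕ} (G : Matrix (Fin n) (Fin n) ℝ) (η : DoubleForm n 2 2) :
    normSq G η = 1 / 4 * ∑ i, ∑ j, ∑ k, ∑ l, η ![i, j] ![k, l] *
      ∑ i', ∑ j', ∑ k', ∑ l', G⁻¹ i i' * G⁻¹ j j' * (G⁻¹ k k' * G⁻¹ l l') *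
        η ![i', j'] ![k', l'] := by
  have h : normSq G η = 1 / 4 * ∑ I, ∑ J, η I J * ∑ I', ∑ J',
      (∏ s, G⁻¹ (I s) (I' s)) * (∏ t, G⁻¹ (J t) (J' t)) * η I' J' := by
    simp only [normSq, Finset.mul_sum]
    refine Finset.sum_congr rfl fun I _ => ?_
    rw [Finset.sum_comm]
    refine Finset.sum_congr rfl fun _ _ => Finset.sum_congr rfl fun _ _ =>
      Finset.sum_congr rfl fun _ _ => ?_
    norm_num [Nat.factorial]
    ring
  rw [h]
  simp only [sum_fin_two, Fin.prod_univ_two, Matrix.cons_val_zero, Matrix.cons_val_one]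

theorem contraction_apply_one {n : ℕ} (G : Matrix (Fin n) (Fin n) ℝ) (η : DoubleForm n 2 2)
    (j l : Fin n) :
    contraction G η ![j] ![l] = ∑ a, ∑ b, G⁻¹ a b * η ![a, j] ![b, l] := rfl

theorem contraction_apply_zero {n : ℕ} (G : Matrix (Fin n) (Fin n) ℝ) (η : DoubleForm n 1 1) :
    contraction G η ![] ![] = ∑ a, ∑ b, G⁻¹ a b * η ![a] ![b] := rfl

theorem doubleForm_two_ext {n : ℕ} {η θ : DoubleForm n 2 2}
    (h : ∀ i j k l, η ![i, j] ![k, l] = θ ![i, j] ![k, l]) : η = θ := by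
  funext I J
  have hI : ∀ I : Fin 2 → Fin n, I = ![I 0, I 1] := fun I => by ext s; fin_cases s <;> rfl
  rw [hI I, hI J]
  exact h _ _ _ _

/-! ### Raising and tracing with the metric; multiples of the metric -/

section Gram

variable {n : ℕ} {G : Matrix (Fin n) (Fin n) ℝ}

theorem sum_inv_mul (hu : IsUnit G.det) (i k : Fin n) :
    ∑ j, G⁻¹ i j * G j k = if i = k then 1 else 0 := by
  rw [← Matrix.mul_apply, Matrix.nonsing_inv_mul _ hu, Matrix.one_apply]

theorem sum_mul_inv (hu : IsUnit G.det) (i k : Fin n) :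
    ∑ j, G i j * G⁻¹ j k = if i = k then 1 else 0 := by
  rw [← Matrix.mul_apply, Matrix.mul_nonsing_inv _ hu, Matrix.one_apply]

theorem inv_apply_comm (hs : G.IsSymm) (i k : Fin n) : G⁻¹ i k = G⁻¹ k i := by
  have : (G⁻¹).IsSymm := by rw [Matrix.IsSymm, Matrix.transpose_nonsing_inv, hs.eq]
  exact this.apply k i

theorem sum_sum_inv_mul_self (hs : G.IsSymm) (hu : IsUnit G.det) :
    ∑ a, ∑ b, G⁻¹ a b * G a b = n := by
  have h : ∀ a, ∑ b, G⁻¹ a b * G a b = 1 := fun a => by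
    have := sum_inv_mul hu a a
    simp only [if_true] at this
    rw [← this]
    exact Finset.sum_congr rfl fun b _ => by rw [hs.apply]
  simp [h]

theorem raise_gram (hs : G.IsSymm) (hu : IsUnit G.det) (i k : Fin n) :
    ∑ i', ∑ k', G⁻¹ i i' * G⁻¹ k k' * G i' k' = G⁻¹ i k := by
  rw [Finset.sum_comm]
  have h : ∀ k', ∑ i', G⁻¹ i i' * G⁻¹ k k' * G i' k' = G⁻¹ k k' * if i = k' then 1 else 0 := by
    intro k'
    rw [← sum_inv_mul hu, Finset.mul_sum]
    exact Finset.sum_congr rfl fun _ _ => by ring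
  simp only [h]
  simp [inv_apply_comm hs]

theorem normSq_of_eq_smul_gram (hs : G.IsSymm) (hu : IsUnit G.det) (lam : ℝ) {η : DoubleForm n 1 1}
    (h : ∀ i k, η ![i] ![k] = lam * G i k) : normSq G η = n * lam ^ 2 := by
  rw [normSq_bidegree_one]
  have h1 : ∀ i k, ∑ i', ∑ k', G⁻¹ i i' * G⁻¹ k k' * η ![i'] ![k'] = lam * G⁻¹ i k := by
    intro i k
    rw [← raise_gram hs hu, Finset.mul_sum]
    refine Finset.sum_congr rfl fun _ _ => ?_
    rw [Finset.mul_sum]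
    exact Finset.sum_congr rfl fun _ _ => by rw [h]; ring
  rw [← sum_sum_inv_mul_self hs hu, Finset.sum_mul]
  refine Finset.sum_congr rfl fun _ _ => ?_
  rw [Finset.sum_mul]
  exact Finset.sum_congr rfl fun _ _ => by rw [h, h1]; ring

theorem contraction_of_eq_smul_gram (hs : G.IsSymm) (hu : IsUnit G.det) (lam : ℝ) {η : DoubleForm n 1 1}
    (h : ∀ i k, η ![i] ![k] = lam * G i k) : contraction G η ![] ![] = n * lam := by
  rw [contraction_apply_zero, ← sum_sum_inv_mul_self hs hu, Finset.sum_mul]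
  refine Finset.sum_congr rfl fun _ _ => ?_
  rw [Finset.sum_mul]
  exact Finset.sum_congr rfl fun _ _ => by rw [h]; ring

end Gram

/-- The Kulkarni–Nomizu product of two bilinear forms. -/
def kulkarniNomizu {n : ℕ} (G Q : Matrix (Fin n) (Fin n) ℝ) : DoubleForm n 2 2 :=
  fun I J => G (I 0) (J 0) * Q (I 1) (J 1) + G (I 1) (J 1) * Q (I 0) (J 0)
    - G (I 0) (J 1) * Q (I 1) (J 0) - G (I 1) (J 0) * Q (I 0) (J 1)

/-! ### Contraction and norm of a Kulkarni–Nomizu product with the metric -/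

section KulkarniNomizu

variable {n : ℕ} {G Q : Matrix (Fin n) (Fin n) ℝ}

theorem kulkarniNomizu_apply (i j k l : Fin n) :
    kulkarniNomizu G Q ![i, j] ![k, l] =
      G i k * Q j l + G j l * Q i k - G i l * Q j k - G j k * Q i l := rfl

/-- The term with `G a b` traces to `n`, each of the two crossed terms removes one `Q`, and the last
term leaves the trace of `Q`. Symmetry of `Q` is not needed. -/
theorem contraction_kulkarniNomizu (hs : G.IsSymm) (hu : IsUnit G.det) (j l : Fin n) :
    contraction G (kulkarniNomizu G Q) ![j] ![l] =
      (n - 2) * Q j l + G j l * ∑ a, ∑ b, G⁻¹ a b * Q a b := by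
  have h2 : ∑ a, ∑ b, G⁻¹ a b * (G a l * Q j b) = Q j l := by
    have : ∀ b, ∑ a, G⁻¹ a b * (G a l * Q j b) = (if b = l then 1 else 0) * Q j b := fun b => by
      rw [← sum_inv_mul hu, Finset.sum_mul]
      exact Finset.sum_congr rfl fun a _ => by rw [inv_apply_comm hs a b]; ring
    rw [Finset.sum_comm]
    simp [this]
  have h3 : ∑ a, ∑ b, G⁻¹ a b * (G j b * Q a l) = Q j l := by
    have : ∀ a, ∑ b, G⁻¹ a b * (G j b * Q a l) = (if j = a then 1 else 0) * Q a l := fun a => by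
      rw [← sum_mul_inv hu, Finset.sum_mul]
      exact Finset.sum_congr rfl fun b _ => by rw [inv_apply_comm hs a b]; ring
    simp [this]
  have h1 : ∑ a, ∑ b, G⁻¹ a b * (G a b * Q j l) = n * Q j l := by
    simp only [← mul_assoc, ← Finset.sum_mul, sum_sum_inv_mul_self hs hu]
  have h4 : ∑ a, ∑ b, G⁻¹ a b * (G j l * Q a b) = G j l * ∑ a, ∑ b, G⁻¹ a b * Q a b := by
    simp only [Finset.mul_sum]
    exact Finset.sum_congr rfl fun a _ => Finset.sum_congr rfl fun b _ => by ring
  rw [contraction_apply_one]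
  simp only [kulkarniNomizu_apply, mul_sub, mul_add, Finset.sum_sub_distrib,
    Finset.sum_add_distrib, h1, h2, h3, h4]
  ring

theorem contraction_contraction_kulkarniNomizu (hs : G.IsSymm) (hu : IsUnit G.det) :
    contraction G (contraction G (kulkarniNomizu G Q)) ![] ![] =
      (2 * n - 2) * ∑ a, ∑ b, G⁻¹ a b * Q a b := by
  rw [contraction_apply_zero]
  simp only [contraction_kulkarniNomizu hs hu]
  set τ := ∑ a, ∑ b, G⁻¹ a b * Q a b with hτ
  have h1 : ∑ a, ∑ b, G⁻¹ a b * ((n - 2) * Q a b) = (n - 2) * τ := by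
    simp only [hτ, Finset.mul_sum]
    exact Finset.sum_congr rfl fun a _ => Finset.sum_congr rfl fun b _ => by ring
  have h2 : ∑ a, ∑ b, G⁻¹ a b * (G a b * τ) = n * τ := by
    simp only [← mul_assoc, ← Finset.sum_mul, sum_sum_inv_mul_self hs hu]
  simp only [mul_add, Finset.sum_add_distrib, h1, h2]
  ring

theorem sum_raise_mul (H A B : Matrix (Fin n) (Fin n) ℝ) (i j k l : Fin n) :
    ∑ i', ∑ j', ∑ k', ∑ l', H i i' * H j j' * (H k k' * H l l') * (A i' k' * B j' l') =
      (∑ i', ∑ k', H i i' * H k k' * A i' k') * ∑ j', ∑ l', H j j' * H l l' * B j' l' := by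
  rw [Finset.sum_mul_sum]
  refine Finset.sum_congr rfl fun i' _ => Finset.sum_congr rfl fun j' _ => ?_
  rw [Finset.sum_mul_sum]
  exact Finset.sum_congr rfl fun k' _ => Finset.sum_congr rfl fun l' _ => by ring

theorem sum_raise_mul' (H A B : Matrix (Fin n) (Fin n) ℝ) (i j k l : Fin n) :
    ∑ i', ∑ j', ∑ k', ∑ l', H i i' * H j j' * (H k k' * H l l') * (A i' l' * B j' k') =
      (∑ i', ∑ l', H i i' * H l l' * A i' l') * ∑ j', ∑ k', H j j' * H k k' * B j' k' := by
  rw [← sum_raise_mul]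
  refine Finset.sum_congr rfl fun i' _ => Finset.sum_congr rfl fun j' _ => ?_
  rw [Finset.sum_comm]
  refine Finset.sum_congr rfl fun i' _ => Finset.sum_congr rfl fun j' _ => ?_
  ring

/-- Raising indices acts on each factor separately and turns `G` into `G⁻¹`, so the raised form is
again a Kulkarni–Nomizu product and the adjunction below applies to it. -/
theorem raise_kulkarniNomizu (hs : G.IsSymm) (hu : IsUnit G.det) (i j k l : Fin n) :
    ∑ i', ∑ j', ∑ k', ∑ l', G⁻¹ i i' * G⁻¹ j j' * (G⁻¹ k k' * G⁻¹ l l') *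
        kulkarniNomizu G Q ![i', j'] ![k', l'] =
      kulkarniNomizu G⁻¹ (Matrix.of fun j l => ∑ j', ∑ l', G⁻¹ j j' * G⁻¹ l l' * Q j' l')
        ![i, j] ![k, l] := by
  have h2 : ∀ i' j' k' l', G j' l' * Q i' k' = Q i' k' * G j' l' := fun _ _ _ _ => mul_comm _ _
  simp only [kulkarniNomizu_apply, mul_sub, mul_add, Finset.sum_sub_distrib,
    Finset.sum_add_distrib, Matrix.of_apply]
  rw [sum_raise_mul, sum_raise_mul']
  simp only [h2]
  rw [sum_raise_mul, sum_raise_mul']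
  simp only [raise_gram hs hu]
  ring

/-- The contraction is adjoint to the Kulkarni–Nomizu product with the metric. -/
theorem sum_kulkarniNomizu_mul (H S : Matrix (Fin n) (Fin n) ℝ) :
    ∑ i, ∑ j, ∑ k, ∑ l, kulkarniNomizu G Q ![i, j] ![k, l] * kulkarniNomizu H S ![i, j] ![k, l] =
      4 * ∑ j, ∑ l, (∑ i, ∑ k, H i k * kulkarniNomizu G Q ![i, j] ![k, l]) * S j l := by
  -- By antisymmetry in each pair and relabelling of indices, all four terms of the second factor
  -- contribute equally, which gives the constant 4.
  have hl : ∀ i j k l, kulkarniNomizu G Q ![i, j] ![k, l] =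
      - kulkarniNomizu G Q ![j, i] ![k, l] := fun i j k l => by
    simp only [kulkarniNomizu_apply]; ring
  have hr : ∀ i j k l, kulkarniNomizu G Q ![i, j] ![k, l] =
      - kulkarniNomizu G Q ![i, j] ![l, k] := fun i j k l => by
    simp only [kulkarniNomizu_apply]; ring
  set R := fun i j k l => kulkarniNomizu G Q ![i, j] ![k, l] with hR
  have h1 : ∑ i, ∑ j, ∑ k, ∑ l, R i j k l * (H i k * S j l) =
      ∑ j, ∑ l, (∑ i, ∑ k, H i k * R i j k l) * S j l := by
    rw [Finset.sum_comm]
    refine Finset.sum_congr rfl fun j _ => ?_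
    simp only [Finset.sum_mul]
    rw [Finset.sum_comm (s := (Finset.univ : Finset (Fin n))) (t := Finset.univ)
      (f := fun l i => ∑ k, H i k * R i j k l * S j l)]
    refine Finset.sum_congr rfl fun i _ => ?_
    rw [Finset.sum_comm]
    exact Finset.sum_congr rfl fun l _ => Finset.sum_congr rfl fun k _ => by ring
  have h2 : ∑ i, ∑ j, ∑ k, ∑ l, R i j k l * (H j l * S i k) =
      ∑ i, ∑ j, ∑ k, ∑ l, R i j k l * (H i k * S j l) := by
    rw [Finset.sum_comm]
    refine Finset.sum_congr rfl fun j _ => Finset.sum_congr rfl fun i _ => ?_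
    rw [Finset.sum_comm]
    refine Finset.sum_congr rfl fun l _ => Finset.sum_congr rfl fun k _ => ?_
    simp only [hR]
    rw [hl, hr]
    ring
  have h3 : ∑ i, ∑ j, ∑ k, ∑ l, R i j k l * (H i l * S j k) =
      - ∑ i, ∑ j, ∑ k, ∑ l, R i j k l * (H i k * S j l) := by
    simp only [← Finset.sum_neg_distrib]
    refine Finset.sum_congr rfl fun i _ => Finset.sum_congr rfl fun j _ => ?_
    rw [Finset.sum_comm]
    refine Finset.sum_congr rfl fun l _ => Finset.sum_congr rfl fun k _ => ?_
    simp only [hR]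
    rw [hr]
    ring
  have h4 : ∑ i, ∑ j, ∑ k, ∑ l, R i j k l * (H j k * S i l) =
      - ∑ i, ∑ j, ∑ k, ∑ l, R i j k l * (H i k * S j l) := by
    rw [Finset.sum_comm]
    simp only [← Finset.sum_neg_distrib]
    refine Finset.sum_congr rfl fun i _ => Finset.sum_congr rfl fun j _ =>
      Finset.sum_congr rfl fun l _ => Finset.sum_congr rfl fun k _ => ?_
    simp only [hR]
    rw [hl]
    ring
  have h0 : ∀ i j k l, R i j k l * kulkarniNomizu H S ![i, j] ![k, l] =
      R i j k l * (H i k * S j l) + R i j k l * (H j l * S i k)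
        - R i j k l * (H i l * S j k) - R i j k l * (H j k * S i l) := fun i j k l => by
    rw [kulkarniNomizu_apply]; ring
  change ∑ i, ∑ j, ∑ k, ∑ l, R i j k l * kulkarniNomizu H S ![i, j] ![k, l] =
      4 * ∑ j, ∑ l, (∑ i, ∑ k, H i k * R i j k l) * S j l
  simp only [h0, Finset.sum_sub_distrib, Finset.sum_add_distrib, h2, h3, h4, ← h1]
  ring

/-- If `c² (g ∧ Q) = 0`, then `(n - 2) |g ∧ Q|² = |c (g ∧ Q)|²`. -/
theorem normSq_kulkarniNomizu (hn : 2 ≤ n) (hs : G.IsSymm) (hu : IsUnit G.det)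
    (h : contraction G (contraction G (kulkarniNomizu G Q)) ![] ![] = 0) :
    (n - 2) * normSq G (kulkarniNomizu G Q) = normSq G (contraction G (kulkarniNomizu G Q)) := by
  have hn' : (2 : ℝ) ≤ n := by exact_mod_cast hn
  rw [contraction_contraction_kulkarniNomizu hs hu] at h
  have hτ : ∑ a, ∑ b, G⁻¹ a b * Q a b = 0 := by
    rcases mul_eq_zero.1 h with h | h
    · linarith
    · exact h
  have hric : ∀ j l, contraction G (kulkarniNomizu G Q) ![j] ![l] = (n - 2) * Q j l :=
    fun j l => by rw [contraction_kulkarniNomizu hs hu, hτ]; ring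
  rw [normSq_bidegree_two, normSq_bidegree_one]
  simp only [raise_kulkarniNomizu hs hu, sum_kulkarniNomizu_mul, ← contraction_apply_one, hric,
    Matrix.of_apply]
  -- The normalisation `1 / (2! 2!)` of the norm cancels the 4 from the adjunction.
  rw [← mul_assoc (1 / 4 : ℝ) 4, Finset.mul_sum, Finset.mul_sum]
  refine Finset.sum_congr rfl fun j _ => ?_
  rw [Finset.mul_sum, Finset.mul_sum]
  refine Finset.sum_congr rfl fun l _ => ?_
  have h5 : ∑ j', ∑ l', G⁻¹ j j' * G⁻¹ l l' * ((n - 2) * Q j' l') =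
      (n - 2) * ∑ j', ∑ l', G⁻¹ j j' * G⁻¹ l l' * Q j' l' := by
    simp only [Finset.mul_sum]
    exact Finset.sum_congr rfl fun a _ => Finset.sum_congr rfl fun b _ => by ring
  rw [h5]
  ring

end KulkarniNomizu

/-! ### Smoothness and positivity of the metric coefficients in a chart -/

section

variable {n : ℕ} {M : Type*} [TopologicalSpace M] [ChartedSpace (EuclideanSpace ℝ (Fin n)) M]
  [IsManifold (𝓡 n) ∞ M]

/-- The coordinate field is the tangent map of the inverse chart applied to a constant vector field.
-/
theorem contMDiffOn_coordVec (x : M) (i : Fin n) :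
    ContMDiffOn 𝓘(ℝ, EuclideanSpace ℝ (Fin n)) (𝓡 n).tangent ∞
      (fun y => (⟨(extChartAt (𝓡 n) x).symm y, coordVec x y i⟩ : TangentBundle (𝓡 n) M))
      (extChartAt (𝓡 n) x).target := by
  have ho : IsOpen (extChartAt (𝓡 n) x).target := isOpen_extChartAt_target x
  have h1 : ContMDiffOn _ _ ∞ _ _ :=
    (contMDiffOn_extChartAt_symm (I := 𝓡 n) (n := ∞) x).contMDiffOn_tangentMapWithin
    (m := ∞) le_rfl ho.uniqueMDiffOn
  have h2 : ContMDiff 𝓘(ℝ, EuclideanSpace ℝ (Fin n)) 𝓘(ℝ, EuclideanSpace ℝ (Fin n)).tangent ∞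
      (fun y => (⟨y, EuclideanSpace.single i (1 : ℝ)⟩ :
        TangentBundle 𝓘(ℝ, EuclideanSpace ℝ (Fin n)) (EuclideanSpace ℝ (Fin n)))) := by
    exact contMDiff_vectorSpace_iff_contDiff.2 contDiff_const
  have h3 := h1.comp (s := (extChartAt (𝓡 n) x).target) h2.contMDiffOn (fun y hy => hy)
  refine h3.congr fun y hy => ?_
  simp only [Function.comp, tangentMapWithin, coordVec]
  rw [mfderivWithin_of_isOpen ho hy]

theorem contDiffOn_coeff (g : Bundle.ContMDiffRiemannianMetric (𝓡 n) ∞ (EuclideanSpace ℝ (Fin n))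
      (TangentSpace (𝓡 n) : M → Type _)) (x : M) (i j : Fin n) :
    ContDiffOn ℝ ∞ (fun y => coeff g.inner x y i j) (extChartAt (𝓡 n) x).target := by
  have hg := g.contMDiff.comp_contMDiffOn (contMDiffOn_extChartAt_symm (I := 𝓡 n) (n := ∞) x)
  have h := ContMDiffOn.clm_bundle_apply₂ (F₁ := EuclideanSpace ℝ (Fin n))
    (F₂ := EuclideanSpace ℝ (Fin n)) (F₃ := ℝ)
    (E₃ := fun _ : M => ℝ) hg
    (contMDiffOn_coordVec x i) (contMDiffOn_coordVec x j)
  intro y hy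
  have h' := h y hy
  rw [Bundle.contMDiffWithinAt_totalSpace] at h'
  exact h'.2.contDiffWithinAt

theorem coordVec_linearCombination_ne_zero (x : M) {y : EuclideanSpace ℝ (Fin n)}
    (hy : y ∈ (extChartAt (𝓡 n) x).target) {c : Fin n → ℝ} (hc : c ≠ 0) :
    ∑ i, c i • coordVec x y i ≠ 0 := by
  have hinv := isInvertible_mfderivWithin_extChartAt_symm (I := 𝓡 n) hy
  have hmf : mfderivWithin 𝓘(ℝ, EuclideanSpace ℝ (Fin n)) (𝓡 n) (extChartAt (𝓡 n) x).symm
      (Set.range (𝓡 n)) y = mfderiv 𝓘(ℝ, EuclideanSpace ℝ (Fin n)) (𝓡 n)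
        (extChartAt (𝓡 n) x).symm y := by
    rw [ModelWithCorners.range_eq_univ, mfderivWithin_univ]
  rw [hmf] at hinv
  intro h0
  simp only [coordVec] at h0
  have h1 : mfderiv 𝓘(ℝ, EuclideanSpace ℝ (Fin n)) (𝓡 n) (extChartAt (𝓡 n) x).symm y
      (WithLp.toLp 2 c : EuclideanSpace ℝ (Fin n)) = 0 := by
    rw [← h0]
    have hs : (WithLp.toLp 2 c : EuclideanSpace ℝ (Fin n))
        = ∑ i, c i • EuclideanSpace.single i (1 : ℝ) := by
      ext j
      simp [Finset.sum_apply, Pi.single_apply]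
    rw [hs]
    erw [map_sum]
    exact Finset.sum_congr rfl fun i _ => ContinuousLinearMap.map_smul _ _ _
  have h2 := hinv.injective (h1.trans (map_zero _).symm)
  apply hc
  funext i
  exact congrArg (fun v : EuclideanSpace ℝ (Fin n) => v i) h2

theorem posDef_coeff (g : Bundle.ContMDiffRiemannianMetric (𝓡 n) ∞ (EuclideanSpace ℝ (Fin n))
      (TangentSpace (𝓡 n) : M → Type _)) (x : M) {y : EuclideanSpace ℝ (Fin n)}
    (hy : y ∈ (extChartAt (𝓡 n) x).target) : (coeff g.inner x y).PosDef := by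
  refine Matrix.PosDef.of_dotProduct_mulVec_pos ?_ fun c hc => ?_
  · ext i j
    exact g.symm _ _ _
  · refine (g.pos _ _ (coordVec_linearCombination_ne_zero x hy hc)).trans_eq ?_
    simp only [map_sum, map_smul, dotProduct, Matrix.mulVec, coeff, Matrix.of_apply,
      sum_apply, smul_apply, smul_eq_mul, Pi.star_apply,
      star_trivial, Finset.mul_sum]
    rw [Finset.sum_comm]
    exact Finset.sum_congr rfl fun _ _ => Finset.sum_congr rfl fun _ _ => by ring

theorem posDef_gram (g : Bundle.ContMDiffRiemannianMetric (𝓡 n) ∞ (EuclideanSpace ℝ (Fin n))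
      (TangentSpace (𝓡 n) : M → Type _)) (x : M) : (gram g.inner x).PosDef :=
  posDef_coeff g x (mem_extChartAt_target x)

end

/-! ### Calculus of partial derivatives -/

section PartialDeriv

variable {n : ℕ} {F H : EuclideanSpace ℝ (Fin n) → ℝ} {y : EuclideanSpace ℝ (Fin n)} (i : Fin n)

theorem partialDeriv_add (hF : DifferentiableAt ℝ F y) (hH : DifferentiableAt ℝ H y) :
    partialDeriv i (fun z => F z + H z) y = partialDeriv i F y + partialDeriv i H y := by
  simp only [partialDeriv]
  rw [fderiv_fun_add hF hH]
  rfl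

theorem partialDeriv_sub (hF : DifferentiableAt ℝ F y) (hH : DifferentiableAt ℝ H y) :
    partialDeriv i (fun z => F z - H z) y = partialDeriv i F y - partialDeriv i H y := by
  simp only [partialDeriv]
  rw [fderiv_fun_sub hF hH]
  rfl

theorem partialDeriv_mul (hF : DifferentiableAt ℝ F y) (hH : DifferentiableAt ℝ H y) :
    partialDeriv i (fun z => F z * H z) y =
      partialDeriv i F y * H y + F y * partialDeriv i H y := by
  simp only [partialDeriv]
  rw [fderiv_fun_mul hF hH]
  simp only [add_apply, smul_apply, smul_eq_mul]
  ring

theorem partialDeriv_sum {ι : Type*} {s : Finset ι} {F : ι → EuclideanSpace ℝ (Fin n) → ℝ}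
    (hF : ∀ a ∈ s, DifferentiableAt ℝ (F a) y) :
    partialDeriv i (fun z => ∑ a ∈ s, F a z) y = ∑ a ∈ s, partialDeriv i (F a) y := by
  simp only [partialDeriv]
  rw [fderiv_fun_sum hF, sum_apply]

theorem partialDeriv_congr (h : F =ᶠ[𝓝 y] H) : partialDeriv i F y = partialDeriv i H y := by
  simp only [partialDeriv, h.fderiv_eq]

theorem partialDeriv_exp_two_mul (hF : DifferentiableAt ℝ F y) :
    partialDeriv i (fun z => Real.exp (2 * F z)) y =
      Real.exp (2 * F y) * (2 * partialDeriv i F y) := by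
  simp only [partialDeriv]
  rw [fderiv_exp (hF.const_mul 2), fderiv_const_mul hF]
  simp

theorem contDiffOn_partialDeriv {Ω : Set (EuclideanSpace ℝ (Fin n))} (hΩ : IsOpen Ω)
    (hF : ContDiffOn ℝ ∞ F Ω) : ContDiffOn ℝ ∞ (partialDeriv i F) Ω :=
  (hF.fderiv_of_isOpen hΩ (m := ∞) le_rfl).clm_apply contDiffOn_const

theorem partialDeriv_comm (hF : ContDiffAt ℝ ∞ F y) (j : Fin n) :
    partialDeriv i (partialDeriv j F) y = partialDeriv j (partialDeriv i F) y := by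
  have hd : DifferentiableAt ℝ (fderiv ℝ F) y :=
    (hF.fderiv_right (m := 1) (WithTop.coe_le_coe.2 (le_top : (2 : ℕ∞) ≤ ⊤))).differentiableAt one_ne_zero
  have h : ∀ a b : Fin n, partialDeriv a (partialDeriv b F) y =
      fderiv ℝ (fderiv ℝ F) y (EuclideanSpace.single a 1) (EuclideanSpace.single b 1) := by
    intro a b
    change fderiv ℝ (fun z => fderiv ℝ F z (EuclideanSpace.single b 1)) y _ = _
    rw [fderiv_clm_apply hd (differentiableAt_const _)]
    simp
  rw [h, h]
  exact (hF.isSymmSndFDerivAt (by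
    simpa using WithTop.coe_le_coe.2 (le_top : (2 : ℕ∞) ≤ ⊤))).eq _ _

end PartialDeriv

/-- Cramer's rule: an entry of the inverse is a determinant with one row replaced by a constant unit
vector, divided by a nonvanishing determinant. -/
theorem contDiffOn_matrix_inv_apply {E : Type*} [NormedAddCommGroup E] [NormedSpace ℝ E] {n : ℕ}
    {G : E → Matrix (Fin n) (Fin n) ℝ} {Ω : Set E}
    (hG : ∀ i j, ContDiffOn ℝ ∞ (fun z => G z i j) Ω) (hu : ∀ z ∈ Ω, IsUnit (G z).det)
    (i j : Fin n) : ContDiffOn ℝ ∞ (fun z => (G z)⁻¹ i j) Ω := by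
  have hdet : ∀ A : E → Matrix (Fin n) (Fin n) ℝ, (∀ i j, ContDiffOn ℝ ∞ (fun z => A z i j) Ω) →
      ContDiffOn ℝ ∞ (fun z => (A z).det) Ω := by
    intro A hA
    simp only [Matrix.det_apply, Units.smul_def, zsmul_eq_mul]
    exact ContDiffOn.sum fun σ _ => contDiffOn_const.mul (contDiffOn_prod fun i _ => hA _ _)
  simp only [Matrix.inv_def, Ring.inverse_eq_inv', Matrix.smul_apply, smul_eq_mul,
    Matrix.adjugate_apply]
  refine ((hdet G hG).inv fun z hz => (hu z hz).ne_zero).mul (hdet _ fun a b => ?_)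
  by_cases h : a = j
  · subst h
    simpa using contDiffOn_const
  · simpa [Matrix.updateRow_ne h] using hG a b

/-- The Christoffel symbols of the Levi-Civita connection of a metric on an open subset of
Euclidean space, given by its matrix. -/
noncomputable def matrixChristoffel {n : ℕ} (G : EuclideanSpace ℝ (Fin n) → Matrix (Fin n) (Fin n) ℝ)
    (k i j : Fin n) (y : EuclideanSpace ℝ (Fin n)) : ℝ :=
  1 / 2 * ∑ l, (G y)⁻¹ k l *
    (partialDeriv i (fun z => G z j l) y + partialDeriv j (fun z => G z i l) y
      - partialDeriv l (fun z => G z i j) y)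

/-- The curvature coefficients of a metric on an open subset of Euclidean space, given by its
matrix. -/
noncomputable def matrixCurvature {n : ℕ} (G : EuclideanSpace ℝ (Fin n) → Matrix (Fin n) (Fin n) ℝ)
    (m l i j : Fin n) (y : EuclideanSpace ℝ (Fin n)) : ℝ :=
  partialDeriv i (matrixChristoffel G m j l) y - partialDeriv j (matrixChristoffel G m i l) y
    + ∑ a, (matrixChristoffel G m i a y * matrixChristoffel G a j l y
      - matrixChristoffel G m j a y * matrixChristoffel G a i l y)

/-- The difference of the Christoffel symbols of `e^{2F} G` and of `G`. -/
noncomputable def conformalDifference {n : ℕ} (G : EuclideanSpace ℝ (Fin n) → Matrix (Fin n) (Fin n) ℝ)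
    (F : EuclideanSpace ℝ (Fin n) → ℝ) (k i j : Fin n) (y : EuclideanSpace ℝ (Fin n)) : ℝ :=
  (if k = j then 1 else 0) * partialDeriv i F y + (if k = i then 1 else 0) * partialDeriv j F y
    - G y i j * ∑ l, (G y)⁻¹ k l * partialDeriv l F y

/-! ### Christoffel symbols under a conformal change -/

section Conformal

variable {n : ℕ} {G : EuclideanSpace ℝ (Fin n) → Matrix (Fin n) (Fin n) ℝ}
  {F : EuclideanSpace ℝ (Fin n) → ℝ} {y : EuclideanSpace ℝ (Fin n)}

/-- The factor `e^{2F}` cancels against its inverse; what survives comes from differentiating it,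
and half of `2 ∂F` gives the coefficient 1. -/
theorem matrixChristoffel_conformal (hs : (G y).IsSymm) (hu : IsUnit (G y).det)
    (hG : ∀ i j, DifferentiableAt ℝ (fun z => G z i j) y) (hF : DifferentiableAt ℝ F y)
    (k i j : Fin n) :
    matrixChristoffel (fun z => Real.exp (2 * F z) • G z) k i j y =
      matrixChristoffel G k i j y + conformalDifference G F k i j y := by
  have hE : DifferentiableAt ℝ (fun z => Real.exp (2 * F z)) y := (hF.const_mul 2).exp
  have hd : ∀ a b c, partialDeriv a (fun z => (Real.exp (2 * F z) • G z) b c) y =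
      Real.exp (2 * F y) *
        (partialDeriv a (fun z => G z b c) y + 2 * partialDeriv a F y * G y b c) := by
    intro a b c
    simp only [Matrix.smul_apply, smul_eq_mul]
    rw [partialDeriv_mul a hE (hG b c), partialDeriv_exp_two_mul a hF]
    ring
  have hinv : ∀ a b, (Real.exp (2 * F y) • G y)⁻¹ a b =
      (Real.exp (2 * F y))⁻¹ * (G y)⁻¹ a b := by
    intro a b
    have := Matrix.inv_smul' (A := G y) (Units.mk0 _ (Real.exp_ne_zero (2 * F y))) hu
    have h2 := congrFun (congrFun this a) b
    simpa [Units.smul_def] using h2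
  have h1 : ∑ l, (G y)⁻¹ k l * (partialDeriv i F y * G y j l) =
      (if k = j then 1 else 0) * partialDeriv i F y := by
    rw [← sum_inv_mul hu, Finset.sum_mul]
    exact Finset.sum_congr rfl fun l _ => by rw [hs.apply]; ring
  have h2 : ∑ l, (G y)⁻¹ k l * (partialDeriv j F y * G y i l) =
      (if k = i then 1 else 0) * partialDeriv j F y := by
    rw [← sum_inv_mul hu, Finset.sum_mul]
    exact Finset.sum_congr rfl fun l _ => by rw [hs.apply]; ring
  simp only [matrixChristoffel, conformalDifference, hd, hinv]
  rw [← h1, ← h2, Finset.mul_sum, Finset.mul_sum, Finset.mul_sum, ← Finset.sum_add_distrib,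
    ← Finset.sum_sub_distrib, ← Finset.sum_add_distrib]
  refine Finset.sum_congr rfl fun l _ => ?_
  field_simp
  ring

theorem contDiffOn_matrixChristoffel {Ω : Set (EuclideanSpace ℝ (Fin n))} (hΩ : IsOpen Ω)
    (hG : ∀ i j, ContDiffOn ℝ ∞ (fun z => G z i j) Ω) (hu : ∀ z ∈ Ω, IsUnit (G z).det)
    (k i j : Fin n) : ContDiffOn ℝ ∞ (matrixChristoffel G k i j) Ω :=
  contDiffOn_const.mul (ContDiffOn.sum fun l _ => (contDiffOn_matrix_inv_apply hG hu k l).mul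
    (((contDiffOn_partialDeriv i hΩ (hG j l)).add (contDiffOn_partialDeriv j hΩ (hG i l))).sub
      (contDiffOn_partialDeriv l hΩ (hG i j))))

theorem contDiffOn_conformalDifference {Ω : Set (EuclideanSpace ℝ (Fin n))} (hΩ : IsOpen Ω)
    (hG : ∀ i j, ContDiffOn ℝ ∞ (fun z => G z i j) Ω) (hu : ∀ z ∈ Ω, IsUnit (G z).det)
    (hF : ContDiffOn ℝ ∞ F Ω) (k i j : Fin n) :
    ContDiffOn ℝ ∞ (conformalDifference G F k i j) Ω :=
  ((contDiffOn_const.mul (contDiffOn_partialDeriv i hΩ hF)).add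
    (contDiffOn_const.mul (contDiffOn_partialDeriv j hΩ hF))).sub
    ((hG i j).mul (ContDiffOn.sum fun l _ => (contDiffOn_matrix_inv_apply hG hu k l).mul
      (contDiffOn_partialDeriv l hΩ hF)))

end Conformal

/-! ### Curvature under a conformal change -/

section Conformal

variable {n : ℕ} {G : EuclideanSpace ℝ (Fin n) → Matrix (Fin n) (Fin n) ℝ}
  {F : EuclideanSpace ℝ (Fin n) → ℝ} {y : EuclideanSpace ℝ (Fin n)}

/-- The bilinear form `Hess F - dF ⊗ dF + ½ |dF|² G`. -/
noncomputable def conformalHessian (G : EuclideanSpace ℝ (Fin n) → Matrix (Fin n) (Fin n) ℝ)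
    (F : EuclideanSpace ℝ (Fin n) → ℝ) (y : EuclideanSpace ℝ (Fin n)) :
    Matrix (Fin n) (Fin n) ℝ :=
  Matrix.of fun i j => partialDeriv i (partialDeriv j F) y
    - ∑ a, matrixChristoffel G a i j y * partialDeriv a F y
    - partialDeriv i F y * partialDeriv j F y
    + 1 / 2 * (∑ a, partialDeriv a F y * ∑ b, (G y)⁻¹ a b * partialDeriv b F y) * G y i j

theorem sum_mul_inv_mul (hu : IsUnit (G y).det) (k : Fin n) (v : Fin n → ℝ) :
    ∑ m, G y k m * ∑ l, (G y)⁻¹ m l * v l = v k := by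
  have : (G y).mulVec ((G y)⁻¹.mulVec v) = v := by
    rw [Matrix.mulVec_mulVec, Matrix.mul_nonsing_inv _ hu, Matrix.one_mulVec]
  exact congrFun this k

/-- The Christoffel symbols of the first kind. -/
noncomputable def lowerChristoffel (G : EuclideanSpace ℝ (Fin n) → Matrix (Fin n) (Fin n) ℝ)
    (k i j : Fin n) (y : EuclideanSpace ℝ (Fin n)) : ℝ :=
  1 / 2 * (partialDeriv i (fun z => G z j k) y + partialDeriv j (fun z => G z i k) y
      - partialDeriv k (fun z => G z i j) y)

theorem lower_matrixChristoffel (hu : IsUnit (G y).det) (k i j : Fin n) :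
    ∑ m, G y k m * matrixChristoffel G m i j y = lowerChristoffel G k i j y := by
  rw [lowerChristoffel, ← sum_mul_inv_mul hu k fun l => partialDeriv i (fun z => G z j l) y
    + partialDeriv j (fun z => G z i l) y - partialDeriv l (fun z => G z i j) y, Finset.mul_sum]
  exact Finset.sum_congr rfl fun m _ => by rw [matrixChristoffel]; ring

theorem partialDeriv_comm_of_isSymm (hs : ∀ᶠ z in 𝓝 y, (G z).IsSymm) (l i j : Fin n) :
    partialDeriv l (fun z => G z i j) y = partialDeriv l (fun z => G z j i) y :=
  partialDeriv_congr l (hs.mono fun _ hz => hz.apply j i)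

theorem lowerChristoffel_comm (hs : ∀ᶠ z in 𝓝 y, (G z).IsSymm) (k i j : Fin n) :
    lowerChristoffel G k i j y = lowerChristoffel G k j i y := by
  simp only [lowerChristoffel, partialDeriv_comm_of_isSymm hs k i j]
  ring

/-- Compatibility of the Levi-Civita connection with the metric, in coordinates. -/
theorem partialDeriv_eq_lowerChristoffel_add (hs : ∀ᶠ z in 𝓝 y, (G z).IsSymm) (i k m : Fin n) :
    partialDeriv i (fun z => G z k m) y = lowerChristoffel G k i m y + lowerChristoffel G m i k y := by
  simp only [lowerChristoffel, partialDeriv_comm_of_isSymm hs i m k,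
    partialDeriv_comm_of_isSymm hs k i m, partialDeriv_comm_of_isSymm hs m i k]
  ring

theorem sum_partialDeriv_mul_conformalDifference (i j : Fin n) :
    ∑ a, partialDeriv a F y * conformalDifference G F a i j y =
      2 * partialDeriv i F y * partialDeriv j F y
        - G y i j * ∑ a, partialDeriv a F y * ∑ b, (G y)⁻¹ a b * partialDeriv b F y := by
  have h1 : ∑ m, partialDeriv m F y * (G y i j * ∑ l, (G y)⁻¹ m l * partialDeriv l F y) =
      G y i j * ∑ a, partialDeriv a F y * ∑ b, (G y)⁻¹ a b * partialDeriv b F y := by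
    rw [Finset.mul_sum]
    exact Finset.sum_congr rfl fun m _ => by ring
  simp only [conformalDifference, mul_sub, mul_add, Finset.sum_sub_distrib,
    Finset.sum_add_distrib, h1]
  simp
  ring

theorem lower_conformalDifference (hu : IsUnit (G y).det) (k i j : Fin n) :
    ∑ m, G y k m * conformalDifference G F m i j y =
      G y k j * partialDeriv i F y + G y k i * partialDeriv j F y
        - G y i j * partialDeriv k F y := by
  have h := sum_mul_inv_mul hu k fun l => partialDeriv l F y
  have h1 : ∑ m, G y k m * (G y i j * ∑ l, (G y)⁻¹ m l * partialDeriv l F y) =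
      G y i j * partialDeriv k F y := by
    rw [← h, Finset.mul_sum]
    exact Finset.sum_congr rfl fun m _ => by ring
  simp only [conformalDifference, mul_sub, mul_add, Finset.sum_sub_distrib,
    Finset.sum_add_distrib, h1]
  simp

/-- Differentiating the lowered identity `lower_conformalDifference`, in which `G⁻¹` no longer
occurs, avoids computing a derivative of `G⁻¹`. -/
theorem partialDeriv_mul_conformalDifference
    (hu : ∀ᶠ z in 𝓝 y, IsUnit (G z).det)
    (hG : ∀ i j, DifferentiableAt ℝ (fun z => G z i j) y)
    (hφ : ∀ a, DifferentiableAt ℝ (partialDeriv a F) y)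
    (hT : ∀ k i j, DifferentiableAt ℝ (conformalDifference G F k i j) y) (i k j l : Fin n) :
    ∑ m, (partialDeriv i (fun z => G z k m) y * conformalDifference G F m j l y
      + G y k m * partialDeriv i (conformalDifference G F m j l) y) =
    (partialDeriv i (fun z => G z k l) y * partialDeriv j F y
      + G y k l * partialDeriv i (partialDeriv j F) y)
    + (partialDeriv i (fun z => G z k j) y * partialDeriv l F y
      + G y k j * partialDeriv i (partialDeriv l F) y)
    - (partialDeriv i (fun z => G z j l) y * partialDeriv k F y
      + G y j l * partialDeriv i (partialDeriv k F) y) := by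
  have h := partialDeriv_congr i (hu.mono fun _ hz =>
    lower_conformalDifference (F := F) hz k j l)
  rw [partialDeriv_sum (F := fun m z => G z k m * conformalDifference G F m j l z) i
      fun m _ => (hG k m).fun_mul (hT m j l),
    partialDeriv_sub i (((hG k l).fun_mul (hφ j)).fun_add ((hG k j).fun_mul (hφ l)))
      ((hG j l).fun_mul (hφ k)),
    partialDeriv_add i ((hG k l).fun_mul (hφ j)) ((hG k j).fun_mul (hφ l)),
    partialDeriv_mul i (hG k l) (hφ j), partialDeriv_mul i (hG k j) (hφ l),
    partialDeriv_mul i (hG j l) (hφ k)] at h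
  rw [← h]
  exact Finset.sum_congr rfl fun m _ => (partialDeriv_mul i (hG k m) (hT m j l)).symm

theorem sum_mul_sum_comm {ι : Type*} [Fintype ι] (u : ι → ℝ) (A : ι → ι → ℝ) (v : ι → ℝ) :
    ∑ m, u m * ∑ a, A m a * v a = ∑ a, (∑ m, u m * A m a) * v a := by
  simp only [Finset.mul_sum, Finset.sum_mul]
  rw [Finset.sum_comm]
  exact Finset.sum_congr rfl fun _ _ => Finset.sum_congr rfl fun _ _ => by ring

/-- The contribution of `∂ᵢ` to the change of the lowered curvature. -/
theorem lower_conformalDifference_derivative (hs : ∀ᶠ z in 𝓝 y, (G z).IsSymm)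
    (hu : ∀ᶠ z in 𝓝 y, IsUnit (G z).det)
    (hG : ∀ i j, DifferentiableAt ℝ (fun z => G z i j) y)
    (hφ : ∀ a, DifferentiableAt ℝ (partialDeriv a F) y)
    (hT : ∀ k i j, DifferentiableAt ℝ (conformalDifference G F k i j) y) (i j k l : Fin n) :
    ∑ m, G y k m * (partialDeriv i (conformalDifference G F m j l) y +
      ∑ a, (matrixChristoffel G m i a y * conformalDifference G F a j l y +
        conformalDifference G F m i a y * matrixChristoffel G a j l y +
        conformalDifference G F m i a y * conformalDifference G F a j l y)) =
    partialDeriv i (fun z => G z k l) y * partialDeriv j F y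
      + G y k l * partialDeriv i (partialDeriv j F) y
    + (partialDeriv i (fun z => G z k j) y * partialDeriv l F y
      + G y k j * partialDeriv i (partialDeriv l F) y)
    - (partialDeriv i (fun z => G z j l) y * partialDeriv k F y
      + G y j l * partialDeriv i (partialDeriv k F) y)
    - (lowerChristoffel G l i k y * partialDeriv j F y
      + lowerChristoffel G j i k y * partialDeriv l F y
      - G y j l * ∑ a, matrixChristoffel G a i k y * partialDeriv a F y)
    + (lowerChristoffel G k j l y * partialDeriv i F y
      + G y k i * (∑ a, matrixChristoffel G a j l y * partialDeriv a F y)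
      - lowerChristoffel G i j l y * partialDeriv k F y)
    + ((G y k l * partialDeriv j F y + G y k j * partialDeriv l F y
        - G y j l * partialDeriv k F y) * partialDeriv i F y
      + G y k i * (2 * partialDeriv j F y * partialDeriv l F y
        - G y j l * ∑ a, partialDeriv a F y * ∑ b, (G y)⁻¹ a b * partialDeriv b F y)
      - (G y i l * partialDeriv j F y + G y i j * partialDeriv l F y
        - G y j l * partialDeriv i F y) * partialDeriv k F y) := by
  have hu' := hu.self_of_nhds
  have hs' := hs.self_of_nhds
  have hb := partialDeriv_mul_conformalDifference hu hG hφ hT i k j l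
  -- Metric compatibility splits `∂ᵢ G k m` in two: one half is the lowered `Γ T` term of the goal,
  -- the other is the correction computed in `he`.
  simp only [partialDeriv_eq_lowerChristoffel_add hs i k, add_mul, Finset.sum_add_distrib] at hb
  have he : ∑ m, lowerChristoffel G m i k y * conformalDifference G F m j l y =
      lowerChristoffel G l i k y * partialDeriv j F y
      + lowerChristoffel G j i k y * partialDeriv l F y
      - G y j l * ∑ a, matrixChristoffel G a i k y * partialDeriv a F y := by
    have h1 : ∀ m, lowerChristoffel G m i k y * conformalDifference G F m j l y =
        conformalDifference G F m j l y * ∑ a, G y m a * matrixChristoffel G a i k y := fun m => by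
      rw [lower_matrixChristoffel hu', mul_comm]
    have h2 : ∀ a, ∑ m, conformalDifference G F m j l y * G y m a =
        G y a l * partialDeriv j F y + G y a j * partialDeriv l F y
          - G y j l * partialDeriv a F y := fun a => by
      rw [← lower_conformalDifference hu']
      exact Finset.sum_congr rfl fun m _ => by rw [hs'.apply a m, mul_comm]
    rw [Finset.sum_congr rfl fun m _ => h1 m, sum_mul_sum_comm
      (fun m => conformalDifference G F m j l y) (fun m a => G y m a),
      Finset.sum_congr rfl fun a _ => by rw [h2 a]]
    rw [← lower_matrixChristoffel hu', ← lower_matrixChristoffel hu', Finset.sum_mul,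
      Finset.sum_mul, Finset.mul_sum, ← Finset.sum_add_distrib, ← Finset.sum_sub_distrib]
    exact Finset.sum_congr rfl fun a _ => by rw [hs'.apply a l, hs'.apply a j]; ring
  -- Stated for arbitrary `v` in order to serve both the `T Γ` term and the `T T` term.
  have hf : ∀ v : Fin n → ℝ, ∑ a, (∑ m, G y k m * conformalDifference G F m i a y) * v a =
      (∑ a, G y k a * v a) * partialDeriv i F y + G y k i * (∑ a, partialDeriv a F y * v a)
        - (∑ a, G y i a * v a) * partialDeriv k F y := fun v => by
    simp only [lower_conformalDifference hu', Finset.sum_mul, Finset.mul_sum]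
    rw [← Finset.sum_add_distrib, ← Finset.sum_sub_distrib]
    exact Finset.sum_congr rfl fun a _ => by ring
  have hcomm : ∑ a, partialDeriv a F y * matrixChristoffel G a j l y =
      ∑ a, matrixChristoffel G a j l y * partialDeriv a F y :=
    Finset.sum_congr rfl fun a _ => mul_comm _ _
  simp only [mul_add, Finset.sum_add_distrib, sum_mul_sum_comm, hf, lower_matrixChristoffel hu',
    hcomm, sum_partialDeriv_mul_conformalDifference]
  simp only [partialDeriv_eq_lowerChristoffel_add hs i k, lower_conformalDifference hu']
  linear_combination hb - he

/-- Both curvatures are lowered with `G`, not with `e^{2F} G`. Writing the new symbols as `Γ + T`,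
the change of curvature is the contribution of `∂ᵢ` antisymmetrised in `i, j`; the rest is symmetry
of `G`, of `Γ` and of second derivatives. -/
theorem lower_matrixCurvature_conformal {Ω : Set (EuclideanSpace ℝ (Fin n))} (hΩ : IsOpen Ω)
    (hy : y ∈ Ω) (hs : ∀ z ∈ Ω, (G z).IsSymm) (hu : ∀ z ∈ Ω, IsUnit (G z).det)
    (hG : ∀ i j, ContDiffOn ℝ ∞ (fun z => G z i j) Ω) (hF : ContDiffOn ℝ ∞ F Ω)
    (i j k l : Fin n) :
    ∑ m, G y k m * matrixCurvature (fun z => Real.exp (2 * F z) • G z) m l i j y =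
      ∑ m, G y k m * matrixCurvature G m l i j y
        - kulkarniNomizu (G y) (conformalHessian G F y) ![i, j] ![k, l] := by
  have hnhds : Ω ∈ 𝓝 y := hΩ.mem_nhds hy
  have hd : ∀ {f : EuclideanSpace ℝ (Fin n) → ℝ}, ContDiffOn ℝ ∞ f Ω →
      ∀ z ∈ Ω, DifferentiableAt ℝ f z := fun hf z hz =>
    (hf.contDiffAt (hΩ.mem_nhds hz)).differentiableAt (by simp)
  have hΓ := contDiffOn_matrixChristoffel hΩ hG hu
  have hT := contDiffOn_conformalDifference hΩ hG hu hF
  have hsum : ∀ z ∈ Ω, ∀ k i j,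
      matrixChristoffel (fun z => Real.exp (2 * F z) • G z) k i j z =
        matrixChristoffel G k i j z + conformalDifference G F k i j z := fun z hz =>
    matrixChristoffel_conformal (hs z hz) (hu z hz) (fun i j => hd (hG i j) z hz) (hd hF z hz)
  have hder : ∀ a k i j,
      partialDeriv a (matrixChristoffel (fun z => Real.exp (2 * F z) • G z) k i j) y =
        partialDeriv a (matrixChristoffel G k i j) y
          + partialDeriv a (conformalDifference G F k i j) y := fun a k i j => by
    rw [← partialDeriv_add a (hd (hΓ k i j) y hy) (hd (hT k i j) y hy)]
    exact partialDeriv_congr a (Filter.mem_of_superset hnhds fun z hz => hsum z hz k i j)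
  have hs' : ∀ᶠ z in 𝓝 y, (G z).IsSymm := Filter.mem_of_superset hnhds hs
  have hu' : ∀ᶠ z in 𝓝 y, IsUnit (G z).det := Filter.mem_of_superset hnhds hu
  have h := fun i j => lower_conformalDifference_derivative hs' hu'
    (fun i j => hd (hG i j) y hy) (fun a => hd (contDiffOn_partialDeriv a hΩ hF) y hy)
    (fun k i j => hd (hT k i j) y hy) i j k l
  have hsplit : ∑ m, G y k m * matrixCurvature (fun z => Real.exp (2 * F z) • G z) m l i j y =
      ∑ m, G y k m * matrixCurvature G m l i j y +
      (∑ m, G y k m * (partialDeriv i (conformalDifference G F m j l) y +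
        ∑ a, (matrixChristoffel G m i a y * conformalDifference G F a j l y +
          conformalDifference G F m i a y * matrixChristoffel G a j l y +
          conformalDifference G F m i a y * conformalDifference G F a j l y))
      - ∑ m, G y k m * (partialDeriv j (conformalDifference G F m i l) y +
        ∑ a, (matrixChristoffel G m j a y * conformalDifference G F a i l y +
          conformalDifference G F m j a y * matrixChristoffel G a i l y +
          conformalDifference G F m j a y * conformalDifference G F a i l y))) := by
    rw [← Finset.sum_sub_distrib, ← Finset.sum_add_distrib]
    refine Finset.sum_congr rfl fun m _ => ?_
    simp only [matrixCurvature, hder, hsum y hy]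
    have h0 : ∑ a, ((matrixChristoffel G m i a y + conformalDifference G F m i a y) *
          (matrixChristoffel G a j l y + conformalDifference G F a j l y)
        - (matrixChristoffel G m j a y + conformalDifference G F m j a y) *
          (matrixChristoffel G a i l y + conformalDifference G F a i l y)) =
        ∑ a, (matrixChristoffel G m i a y * matrixChristoffel G a j l y
          - matrixChristoffel G m j a y * matrixChristoffel G a i l y) +
        (∑ a, (matrixChristoffel G m i a y * conformalDifference G F a j l y +
          conformalDifference G F m i a y * matrixChristoffel G a j l y +
          conformalDifference G F m i a y * conformalDifference G F a j l y)
        - ∑ a, (matrixChristoffel G m j a y * conformalDifference G F a i l y +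
          conformalDifference G F m j a y * matrixChristoffel G a i l y +
          conformalDifference G F m j a y * conformalDifference G F a i l y)) := by
      rw [← Finset.sum_sub_distrib, ← Finset.sum_add_distrib]
      exact Finset.sum_congr rfl fun a _ => by ring
    rw [h0]
    ring
  have hsy := hs y hy
  rw [hsplit, h i j, h j i, kulkarniNomizu_apply]
  simp only [conformalHessian, Matrix.of_apply, partialDeriv_eq_lowerChristoffel_add hs']
  rw [partialDeriv_comm j (hF.contDiffAt hnhds) i, hsy.apply k j, hsy.apply k i, hsy.apply j i,
    lowerChristoffel_comm hs' k j i, lowerChristoffel_comm hs' l j i]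
  ring

end Conformal

/-! ### The invariant `h₄` in the two geometric cases -/

section

variable {n : ℕ} {M : Type*} [TopologicalSpace M] [ChartedSpace (EuclideanSpace ℝ (Fin n)) M]

theorem riemann_apply (g : BilinField n M) (x : M) (i j k l : Fin n) :
    riemann g x ![i, j] ![k, l] = ∑ m, gram g x k m *
      matrixCurvature (coeff g x) m l i j (extChartAt (𝓡 n) x x) := rfl

theorem coeff_exp_smul (g : BilinField n M) (f : M → ℝ) (x : M) :
    coeff (fun z => Real.exp (2 * f z) • g z) x = fun y =>
      Real.exp (2 * f ((extChartAt (𝓡 n) x).symm y)) • coeff g x y := rfl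

theorem h₄_eq_zero_of_riemann_eq_zero {g : BilinField n M} {x : M} (h : riemann g x = 0) :
    h₄ g x = 0 := by
  simp [h₄, scal₀, ricci, h, contraction_zero, normSq_zero]

variable [IsManifold (𝓡 n) ∞ M]

/-- The curvature of a conformally flat metric is the Kulkarni–Nomizu product of the metric
with a bilinear form. -/
theorem IsConformallyFlat.exists_riemann_eq
    {g : Bundle.ContMDiffRiemannianMetric (𝓡 n) ∞ (EuclideanSpace ℝ (Fin n))
      (TangentSpace (𝓡 n) : M → Type _)} (h : IsConformallyFlat g.inner) (x : M) :
    ∃ Q, riemann g.inner x = kulkarniNomizu (gram g.inner x) Q := by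
  obtain ⟨U, f, hU, hxU, hf, hflat⟩ := h x
  set e := extChartAt (𝓡 n) x with he
  have hΩ : IsOpen (e.target ∩ e.symm ⁻¹' U) :=
    (continuousOn_extChartAt_symm x).isOpen_inter_preimage (isOpen_extChartAt_target x) hU
  have hxΩ : e x ∈ e.target ∩ e.symm ⁻¹' U := by
    refine ⟨mem_extChartAt_target x, ?_⟩
    rw [Set.mem_preimage, he, extChartAt_to_inv]
    exact hxU
  have hF : ContDiffOn ℝ ∞ (fun y => f (e.symm y)) (e.target ∩ e.symm ⁻¹' U) :=
    (hf.comp ((contMDiffOn_extChartAt_symm x).mono Set.inter_subset_left)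
      Set.inter_subset_right).contDiffOn
  have hpos := fun z (hz : z ∈ e.target ∩ e.symm ⁻¹' U) => posDef_coeff g x hz.1
  refine ⟨conformalHessian (coeff g.inner x) (fun y => f (e.symm y)) (e x),
    doubleForm_two_ext fun i j k l => ?_⟩
  have hc := lower_matrixCurvature_conformal hΩ hxΩ (fun z hz => (hpos z hz).isHermitian)
    (fun z hz => (Matrix.isUnit_iff_isUnit_det _).1 (hpos z hz).isUnit)
    (fun i j => (contDiffOn_coeff g x i j).mono Set.inter_subset_left) hF i j k l
  have h0 := congrFun (congrFun (hflat x hxU) ![i, j]) ![k, l]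
  rw [riemann_apply, gram, coeff_exp_smul] at h0
  -- Flatness of `e^{2f} g` concerns the curvature lowered with `e^{2f} g`; the nonzero factor is
  -- divided out to match `hc`.
  simp only [Matrix.smul_apply, smul_eq_mul, mul_assoc, ← Finset.mul_sum, Pi.zero_apply,
    mul_eq_zero, Real.exp_ne_zero, false_or] at h0
  rw [riemann_apply]
  exact sub_eq_zero.1 (hc.symm.trans h0)

theorem normSq_riemann_le_h₄ (hn : 4 ≤ n)
    (g : Bundle.ContMDiffRiemannianMetric (𝓡 n) ∞ (EuclideanSpace ℝ (Fin n))
      (TangentSpace (𝓡 n) : M → Type _)) (x : M) {lam : ℝ}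
    (h : ∀ i j, ricci g.inner x ![i] ![j] = lam * gram g.inner x i j) :
    normSq (gram g.inner x) (riemann g.inner x) ≤ h₄ g.inner x := by
  have hpos := posDef_gram g x
  have hu := (Matrix.isUnit_iff_isUnit_det _).1 hpos.isUnit
  have hs : (gram g.inner x).IsSymm := hpos.isHermitian
  have hn' : (4 : ℝ) ≤ n := by exact_mod_cast hn
  rw [h₄, normSq_of_eq_smul_gram hs hu lam h, normSq_bidegree_zero, scal₀,
    contraction_of_eq_smul_gram hs hu lam h]
  -- The excess over `|R|²` is `n²λ²/4 - nλ² = n(n-4)λ²/4`.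
  nlinarith [mul_nonneg (mul_nonneg (by linarith : (0 : ℝ) ≤ n) (sub_nonneg.2 hn')) (sq_nonneg lam)]

theorem h₄_eq_of_isConformallyFlat (hn : 4 ≤ n)
    {g : Bundle.ContMDiffRiemannianMetric (𝓡 n) ∞ (EuclideanSpace ℝ (Fin n))
      (TangentSpace (𝓡 n) : M → Type _)} (h : IsConformallyFlat g.inner) {x : M}
    (hscal : scalarCurvature g.inner x = 0) :
    h₄ g.inner x = -((n - 3) * normSq (gram g.inner x) (riemann g.inner x)) := by
  have hpos := posDef_gram g x
  have hu := (Matrix.isUnit_iff_isUnit_det _).1 hpos.isUnit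
  have hs : (gram g.inner x).IsSymm := hpos.isHermitian
  obtain ⟨Q, hQ⟩ := h.exists_riemann_eq x
  have h1 : scal₀ g.inner x ![] ![] = 0 := hscal
  have h2 := normSq_kulkarniNomizu (Q := Q) (by omega) hs hu (by rwa [← hQ])
  rw [h₄, normSq_bidegree_zero, h1, ricci, hQ, ← h2]
  ring

end

end HWeyl

theorem mainTheorem1 {n : ℕ} (hn : 4 ≤ n) {M : Type*} [TopologicalSpace M]
    [ChartedSpace (EuclideanSpace ℝ (Fin n)) M] [IsManifold (𝓡 n) ∞ M]
    (g : Bundle.ContMDiffRiemannianMetric (𝓡 n) ∞ (EuclideanSpace ℝ (Fin n))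
      (TangentSpace (𝓡 n) : M → Type _)) :
    (HWeyl.IsEinstein g.inner →
      (∀ x, 0 ≤ HWeyl.h₄ g.inner x) ∧
      ((∀ x, HWeyl.h₄ g.inner x = 0) ↔ HWeyl.IsFlatOn g.inner Set.univ)) ∧
    (HWeyl.IsConformallyFlat g.inner → (∀ x, HWeyl.scalarCurvature g.inner x = 0) →
      (∀ x, HWeyl.h₄ g.inner x ≤ 0) ∧
      ((∀ x, HWeyl.h₄ g.inner x = 0) ↔ HWeyl.IsFlatOn g.inner Set.univ)) := by
  have hn' : (4 : ℝ) ≤ n := by exact_mod_cast hn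
  have hflat : HWeyl.IsFlatOn g.inner Set.univ → ∀ x, HWeyl.h₄ g.inner x = 0 :=
    fun h x => HWeyl.h₄_eq_zero_of_riemann_eq_zero (h x trivial)
  refine ⟨fun ⟨lam, hlam⟩ => ?_, fun hcf hscal => ?_⟩
  · have hle := fun x => HWeyl.normSq_riemann_le_h₄ hn g x (hlam x)
    have hnn := fun x => HWeyl.normSq_nonneg (HWeyl.posDef_gram g x) (HWeyl.riemann g.inner x)
    refine ⟨fun x => (hnn x).trans (hle x), fun h x _ => ?_, hflat⟩
    exact HWeyl.eq_zero_of_normSq_eq_zero (HWeyl.posDef_gram g x)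
      (le_antisymm ((hle x).trans_eq (h x)) (hnn x))
  · have heq := fun x => HWeyl.h₄_eq_of_isConformallyFlat hn hcf (hscal x)
    have hnn := fun x => HWeyl.normSq_nonneg (HWeyl.posDef_gram g x) (HWeyl.riemann g.inner x)
    refine ⟨fun x => ?_, fun h x _ => ?_, hflat⟩
    · rw [heq, neg_nonpos]
      exact mul_nonneg (by linarith) (hnn x)
    · refine HWeyl.eq_zero_of_normSq_eq_zero (HWeyl.posDef_gram g x) ?_
      have h0 := heq x
      rw [h x, zero_eq_neg] at h0
      -- The factor `n - 3` is nonzero since `n ≥ 4`.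
      exact (mul_eq_zero.1 h0).resolve_left (by linarith)
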